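/- A quantum network with $T$ queries to a black box $X=(x_0,\dots,x_{N-1})\in\{0,1\}^N$ starts in the state $|\overline 0\rangle$ of finitely many qubits and applies $U_T O_X U_{T-1} O_X\cdots O_X U_1 O_X U_0$, where the unitaries $U_0,\dots,U_T$ do not depend on $X$ and the query gate $O_X$ maps $|j,b,z\rangle$ to $|j,b\oplus x_j,z\rangle$ for $0\le j<N$ and is the identity on basis states with index $j\ge N$. All qubits are then observed, and the output is a function of the observed bit string that does not depend on $X$. The network computes OR with error probability at most $\varepsilon$ if for every $X\in\{0,1\}^N$ its output differs from $x_0\vee\dots\vee x_{N-1}$ with probability at most $\varepsilon$. It searches an unordered list of $N$ items with error probability at most $\varepsilon$ if for every $X$ its output is, except with probability at most $\varepsilon$, a position $j$ with $x_j=1$, or the answer "none" if all $x_j$ are $0$. Corollary. There is an absolute constant $c>0$ with the following property. Let $T\colon\mathbb N\to\mathbb N$ satisfy $T(N)/\sqrt N\to\infty$ as $N\to\infty$, and $T(N)<N$ for all sufficiently large $N$. For every $N$ let $A_N$ be a quantum network with $T(N)$ queries to a black box of $N$ bits, and suppose that, for all sufficiently large $N$, $A_N$ computes OR with error probability at most $\varepsilon(N)\in\mathbb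 R$; or suppose instead that, for all sufficiently large $N$, $A_N$ searches an unordered list of $N$ items with error probability at most $\varepsilon(N)$. Then for all sufficiently large $N$ we have $\varepsilon(N)>0$ and $$T(N)\ \ge\ c\,\sqrt{N\log(1/\varepsilon(N))},$$ where $\log$ is the natural logarithm and the square root is read as $0$ if $\varepsilon(N)>1$. In particular, $T\in\Omega\bigl(\sqrt{N\log(1/\varepsilon)}\bigr)$. -/

import Mathlib

open Filter

/-- Labels of the computational basis of a register of `k + 1 + w` qubits: an index register of
`k` qubits (bit strings read as integers `j < 2 ^ k`), one target qubit, and `w` further qubits. -/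
abbrev BasisState (k w : ℕ) : Type := Fin (2 ^ k) × Bool × (Fin w → Bool)

/-- The label of the initial state, in which all qubits are `0`. -/
def zeroLabel (k w : ℕ) : BasisState k w :=
  (⟨0, Nat.two_pow_pos k⟩, false, fun _ => false)

/-- The action of a query to `X = (x_0, …, x_{N-1})` on basis labels:
`(j, b, z) ↦ (j, b ⊕ x_j, z)`.
Index strings `j ≥ N`, which denote no item, are left alone. -/
def queryLabel {N k w : ℕ} (X : Fin N → Bool) (s : BasisState k w) : BasisState k w :=
  (s.1, if h : s.1.val < N then xor s.2.1 (X ⟨s.1.val, h⟩) else s.2.1, s.2.2)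

/-- The query gate, as the matrix which sends `|s⟩` to `|queryLabel X s⟩`. -/
def queryGate {N : ℕ} (k w : ℕ) (X : Fin N → Bool) :
    Matrix (BasisState k w) (BasisState k w) ℂ :=
  Matrix.of fun s' s => if s' = queryLabel X s then 1 else 0

/-- A quantum gate network with exactly `T` queries to a black box of `N` bits. It is given by its
numbers of qubits, by unitary transformations `U_0, …, U_T` which do not depend on the black box,
and by the function which reads off the output from the bit string that is observed at the end
(for instance, the value of one specific bit). -/
structure QuantumNetwork (N T : ℕ) (O : Type) where
  /-- number of index qubits -/
  k : ℕ
  /-- they suffice to address every item of the list -/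
  hk : N ≤ 2 ^ k
  /-- number of further qubits, besides the target qubit -/
  w : ℕ
  U : Fin (T + 1) → Matrix.unitaryGroup (BasisState k w) ℂ
  output : BasisState k w → O

namespace QuantumNetwork

variable {N T : ℕ} {O : Type}

/-- The vector of amplitudes `U_t O U_{t-1} O … O U_1 O U_0 |0…0⟩`, on the black box `X`. -/
def stateAfter (A : QuantumNetwork N T O) (X : Fin N → Bool) :
    (t : ℕ) → t < T + 1 → BasisState A.k A.w → ℂ
  | 0, h => (A.U ⟨0, h⟩).1.mulVec (Pi.single (zeroLabel A.k A.w) 1)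
  | t + 1, h => (A.U ⟨t + 1, h⟩).1.mulVec
      ((queryGate A.k A.w X).mulVec (A.stateAfter X t (Nat.lt_of_succ_lt h)))

/-- The vector of amplitudes of the final state `U_T O U_{T-1} O … O U_1 O U_0 |0…0⟩`. -/
def finalState (A : QuantumNetwork N T O) (X : Fin N → Bool) : BasisState A.k A.w → ℂ :=
  A.stateAfter X T (Nat.lt_succ_self T)

open Classical in
/-- The probability that the output of the network on the black box `X` satisfies `P`. -/
noncomputable def outputProb (A : QuantumNetwork N T O) (X : Fin N → Bool) (P : O → Prop) : ℝ :=
  ∑ s : BasisState A.k A.w, if P (A.output s) then ‖A.finalState X s‖ ^ 2 else 0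

/-- The network computes the OR of `N` bits with error probability at most `ε`: on every black box,
the probability of an output other than the OR of its bits is at most `ε`. -/
def ComputesOR (A : QuantumNetwork N T Bool) (ε : ℝ) : Prop :=
  ∀ X : Fin N → Bool, A.outputProb X (fun o => ¬ (o = true ↔ ∃ j, X j = true)) ≤ ε

/-- Correct answers to the search problem on the list `X`: a position `j` such that `x_j = 1`, or
the answer `none` (there is no such position) if the list contains only zeroes. -/
def IsSearchAnswer (X : Fin N → Bool) : Option (Fin N) → Prop
  | none => ∀ j, X j = false
  | some j => X j = true

/-- The network searches an unordered list of `N` items with error probability at most `ε`. -/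
def Searches (A : QuantumNetwork N T (Option (Fin N))) (ε : ℝ) : Prop :=
  ∀ X : Fin N → Bool, A.outputProb X (fun o => ¬ IsSearchAnswer X o) ≤ ε

end QuantumNetwork

/-! After `T` queries every amplitude is a polynomial of degree at most `T` in the bits of `X`. Let
`g X` be the inner product of the final states on the zero input and on `X`, restricted to outcomes
with output `false`. Then `g` has degree at most `T`, `g 0 ≥ 1 - ε`, and by Cauchy-Schwarz `|g X| ≤
√ε` for `X ≠ 0`. Pairing `g` with a signed measure `W` that annihilates degree `T` gives `W 0 * (1 -
ε) ≤ ‖W‖ * √ε`.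

`exists_dual` builds `W` as a product over `D` blocks of coordinates. Each factor is the point mass
at `0` minus a signed mixture of biased product distributions, with weights from Chebyshev
extrapolation, and it annihilates degree `d`. A monomial of degree below `D * (d + 1)` has degree at
most `d` in some block, so that factor kills it. Each block costs a constant factor in the bound and
needs about `d ^ 2` coordinates. Balancing `D * d ≈ T` and `D * d ^ 2 ≈ N` gives `D ≈ T ^ 2 / N`,
hence `log (1 / ε) = O(T ^ 2 / N)`. -/

/-! ### Extrapolation from Chebyshev nodes -/

namespace ChebyshevExtrapolation

open Polynomial Polynomial.Chebyshev

/-- The value at `x` of the Lagrange basis polynomial for the Chebyshev node `i`. -/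
noncomputable def weight (d : ℕ) (x : ℝ) (i : ℕ) : ℝ :=
  (Lagrange.basis (Finset.range (d + 1)) (node d) i).eval x

theorem sum_weight_mul_eval {d : ℕ} (x : ℝ) {P : ℝ[X]} (hP : P.degree < (d + 1 : ℕ)) :
    ∑ i ∈ Finset.range (d + 1), P.eval (node d i) * weight d x i = P.eval x := by
  have h := Lagrange.eq_interpolate (strictAntiOn_node d).injOn
    (f := P) (s := Finset.range (d + 1)) (by simpa using hP)
  conv_rhs => rw [h]
  simp [Lagrange.interpolate_apply, eval_finsetSum, weight]

theorem weight_eq (d : ℕ) (x : ℝ) (i : ℕ) :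
    weight d x i = (∏ j ∈ (Finset.range (d + 1)).erase i, (node d i - node d j))⁻¹ *
      ∏ j ∈ (Finset.range (d + 1)).erase i, (x - node d j) := by
  simp [weight, Lagrange.basis, Lagrange.basisDivisor, eval_prod, Finset.prod_mul_distrib,
    Finset.prod_inv_distrib]

theorem abs_weight {d : ℕ} {x : ℝ} (hx : 1 ≤ x) {i : ℕ} (hi : i ≤ d) :
    |weight d x i| = (-1) ^ i * weight d x i := by
  have h : 0 ≤ (-1) ^ i * weight d x i := by
    have h1 := inv_pos_of_pos (zero_lt_prod_node_sub_node hi)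
    rw [mul_inv, ← inv_pow, inv_neg_one] at h1
    rw [weight_eq, ← mul_assoc]
    refine mul_nonneg h1.le (Finset.prod_nonneg fun j _ => ?_)
    have : node d j ≤ 1 := node_mem_Icc.2
    linarith
  rw [← abs_of_nonneg h, abs_mul]
  simp

/-- To the right of all nodes the weights alternate in sign, exactly as `T ℝ d` alternates between
`1` and `-1` at the nodes. So the absolute sum is the extrapolation of `T ℝ d` itself. -/
theorem sum_abs_weight (d : ℕ) {x : ℝ} (hx : 1 ≤ x) :
    ∑ i ∈ Finset.range (d + 1), |weight d x i| = (T ℝ d).eval x := by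
  rw [← sum_weight_mul_eval (d := d) x (P := T ℝ d) (by simp [degree_T]; norm_cast; omega)]
  refine Finset.sum_congr rfl fun i hi => ?_
  have hi' : i ≤ d := by simpa [Nat.lt_succ_iff] using hi
  rw [abs_weight hx hi', eval_T_real_node (by simpa using hi')]

end ChebyshevExtrapolation

open ChebyshevExtrapolation Polynomial Polynomial.Chebyshev in
/-- Extrapolation to `0` of polynomials of degree at most `d` from nodes in `[0, 1]`, with
bounded total weight, and with the nodes at distance of order `1 / d ^ 2` from `0`. -/
theorem exists_extrapolation_of_pos {d n : ℕ} (hd : 1 ≤ d) (hn : 12 * d ^ 2 ≤ n) :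
    ∃ β τ : ℕ → ℝ, (∀ k, τ k ∈ Set.Icc (0 : ℝ) 1) ∧
      (∀ s ≤ d, ∑ k ∈ Finset.range (d + 1), β k * τ k ^ s = 0 ^ s) ∧
      ∑ k ∈ Finset.range (d + 1), |β k| ≤ 2 ∧
      ∑ k ∈ Finset.range (d + 1), |β k| * (1 - τ k) ^ n ≤ 1 / 2 := by
  have hd0 : (1 : ℝ) ≤ d := by exact_mod_cast hd
  set y : ℝ := 1 / d with hy
  have hy0 : 0 < y := by positivity
  have hy1 : y ≤ 1 := by rw [hy, div_le_one (by linarith)]; exact hd0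
  -- With this choice `T_d x = cosh (d * y) = cosh 1` stays bounded, while `x - 1` is still of order
  -- `1 / d ^ 2`.
  set x : ℝ := Real.cosh y with hx
  have hx1 : 1 + y ^ 2 / 2 ≤ x := by
    have h1 : x = 1 + 2 * Real.sinh (y / 2) ^ 2 := by
      rw [hx, show y = 2 * (y / 2) by ring, Real.cosh_two_mul, Real.cosh_sq]
      ring_nf
    have h2 : y / 2 ≤ Real.sinh (y / 2) := Real.self_le_sinh_iff.2 (by positivity)
    nlinarith
  have hcosh1 : Real.cosh 1 ≤ 2 := by
    rw [Real.cosh_eq]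
    have := Real.exp_one_lt_d9
    have : Real.exp (-1) ≤ 1 := Real.exp_le_one_iff.2 (by norm_num)
    linarith
  have hx2 : x ≤ 2 := by
    refine le_trans ?_ hcosh1
    rw [hx, Real.cosh_le_cosh, abs_of_pos hy0]
    simpa using hy1
  have hx11 : 1 ≤ x := by nlinarith
  have hsum : ∑ k ∈ Finset.range (d + 1), |weight d x k| ≤ 2 := by
    rw [sum_abs_weight d hx11, hx, T_real_cosh]
    have : ((d : ℤ) : ℝ) * y = 1 := by rw [hy]; push_cast; field_simp
    rw [this]
    exact hcosh1
  have hnode (k : ℕ) : -1 ≤ node d k ∧ node d k ≤ 1 := node_mem_Icc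
  have hpos : 0 < x + 1 := by linarith
  have hdecay (k : ℕ) : (1 - (x - node d k) / (x + 1)) ^ n ≤ 1 / 4 := by
    have h1 : y ^ 2 / 6 ≤ (x - node d k) / (x + 1) := by
      rw [le_div_iff₀ hpos]
      have := (hnode k).2
      nlinarith [sq_nonneg y]
    have h0 : 0 ≤ 1 - (x - node d k) / (x + 1) := by
      rw [sub_nonneg, div_le_one hpos]
      linarith [(hnode k).1]
    calc (1 - (x - node d k) / (x + 1)) ^ n ≤ (Real.exp (-(y ^ 2 / 6))) ^ n := by
          refine pow_le_pow_left₀ h0 ?_ n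
          have := Real.add_one_le_exp (-(y ^ 2 / 6))
          linarith
      _ = Real.exp (-(n * (y ^ 2 / 6))) := by rw [← Real.exp_nat_mul]; ring_nf
      _ ≤ Real.exp (-2) := by
          rw [Real.exp_le_exp, neg_le_neg_iff]
          have h2 : (12 * d ^ 2 : ℝ) ≤ n := by exact_mod_cast hn
          have h3 : (12 * d ^ 2 : ℝ) * (y ^ 2 / 6) = 2 := by rw [hy]; field_simp; norm_num
          rw [← h3]
          gcongr
      _ ≤ 1 / 4 := by
          rw [Real.exp_neg, one_div]
          refine inv_anti₀ (by norm_num) ?_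
          have h4 : Real.exp 2 = Real.exp 1 * Real.exp 1 := by rw [← Real.exp_add]; norm_num
          have := Real.add_one_le_exp (1 : ℝ)
          rw [h4]
          nlinarith
  -- The affine map `u ↦ (x - u) / (x + 1)` sends `x` to `0` and `[-1, 1]` into `[0, 1]`.
  refine ⟨weight d x, fun k => (x - node d k) / (x + 1), fun k => ⟨?_, ?_⟩, fun s hs => ?_,
    hsum, ?_⟩
  · exact div_nonneg (by linarith [(hnode k).2]) hpos.le
  · rw [div_le_one hpos]
    linarith [(hnode k).1]
  · have h := sum_weight_mul_eval (d := d) x (P := (C (x + 1)⁻¹ * (C x - X)) ^ s) (by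
      refine lt_of_le_of_lt degree_le_natDegree ?_
      rw [Nat.cast_lt, Nat.lt_succ_iff]
      refine le_trans natDegree_pow_le ?_
      have : (C (x + 1)⁻¹ * (C x - X)).natDegree ≤ 1 := by compute_degree
      nlinarith)
    simp only [eval_pow, eval_mul, eval_C, eval_sub, eval_X, sub_self, mul_zero] at h
    rw [← h]
    refine Finset.sum_congr rfl fun k _ => ?_
    simp only [div_eq_inv_mul, mul_comm]
  · calc _ ≤ ∑ k ∈ Finset.range (d + 1), |weight d x k| * (1 / 4) := by
          gcongr with k _
          exact hdecay k
      _ ≤ 1 / 2 := by rw [← Finset.sum_mul]; linarith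

/-- Extrapolation to `0` of polynomials of degree at most `d` from nodes in `(0, 1]`. -/
theorem exists_extrapolation {d n : ℕ} (h : 12 * d ^ 2 ≤ n) (hn : 1 ≤ n) :
    ∃ β τ : ℕ → ℝ, (∀ k, τ k ∈ Set.Icc (0 : ℝ) 1) ∧
      (∀ s ≤ d, ∑ k ∈ Finset.range (d + 1), β k * τ k ^ s = 0 ^ s) ∧
      ∑ k ∈ Finset.range (d + 1), |β k| ≤ 2 ∧
      ∑ k ∈ Finset.range (d + 1), |β k| * (1 - τ k) ^ n ≤ 1 / 2 := by
  rcases Nat.eq_zero_or_pos d with rfl | hd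
  · refine ⟨fun _ => 1, fun _ => 1, by simp, by simp, by simp, ?_⟩
    have : n ≠ 0 := by omega
    simp [this]
  · exact exists_extrapolation_of_pos hd h

/-! ### Polynomials and product distributions on the cube -/

/-- The value at `X` of the multilinear monomial `∏ i ∈ S, x_i`. -/
def cubeMonomial {N : ℕ} (S : Finset (Fin N)) (X : Fin N → Bool) : ℂ :=
  ∏ i ∈ S, if X i then 1 else 0

/-- Functions on the cube which are polynomials of degree at most `T`. -/
def cubePolynomials (N T : ℕ) : Submodule ℂ ((Fin N → Bool) → ℂ) :=
  Submodule.span ℂ {f | ∃ S : Finset (Fin N), S.card ≤ T ∧ f = cubeMonomial S}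

theorem cubePolynomials_mono {N S T : ℕ} (h : S ≤ T) :
    cubePolynomials N S ≤ cubePolynomials N T :=
  Submodule.span_mono fun _ ⟨M, hM, hf⟩ => ⟨M, hM.trans h, hf⟩

theorem const_mem_cubePolynomials (N T : ℕ) (c : ℂ) :
    (fun _ => c) ∈ cubePolynomials N T := by
  have h : (fun _ => 1 : (Fin N → Bool) → ℂ) ∈ cubePolynomials N T :=
    Submodule.subset_span ⟨∅, by simp, by ext; simp [cubeMonomial]⟩
  convert (cubePolynomials N T).smul_mem c h using 1
  ext
  simp

theorem coord_mul_mem_cubePolynomials {N T : ℕ} (i : Fin N) {f : (Fin N → Bool) → ℂ}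
    (hf : f ∈ cubePolynomials N T) :
    (fun X => (if X i then 1 else 0) * f X) ∈ cubePolynomials N (T + 1) := by
  induction hf using Submodule.span_induction with
  | mem f h =>
    obtain ⟨S, hS, rfl⟩ := h
    refine Submodule.subset_span ⟨insert i S, (Finset.card_insert_le _ _).trans (by omega), ?_⟩
    ext X
    by_cases hi : i ∈ S
    · rw [Finset.insert_eq_of_mem hi, cubeMonomial, ← Finset.mul_prod_erase S _ hi]
      split_ifs <;> simp
    · simp [cubeMonomial, Finset.prod_insert hi]
  | zero =>
    simp only [Pi.zero_apply, mul_zero]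
    exact (cubePolynomials N (T + 1)).zero_mem
  | add f g _ _ hf hg =>
    convert (cubePolynomials N (T + 1)).add_mem hf hg using 1
    ext X
    simp [mul_add]
  | smul c f _ hf =>
    convert (cubePolynomials N (T + 1)).smul_mem c hf using 1
    ext X
    simp only [Pi.smul_apply, smul_eq_mul]
    ring

/-- The product distribution on the cube in which bit `i` is set with probability `t i`. -/
def cubeWeight {N : ℕ} (t : Fin N → ℝ) (X : Fin N → Bool) : ℝ :=
  ∏ i, if X i then t i else 1 - t i

theorem cubeWeight_nonneg {N : ℕ} {t : Fin N → ℝ} (ht : ∀ i, t i ∈ Set.Icc (0 : ℝ) 1)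
    (X : Fin N → Bool) : 0 ≤ cubeWeight t X :=
  Finset.prod_nonneg fun i _ => by
    have := ht i
    split_ifs
    · exact this.1
    · linarith [this.2]

theorem sum_cubeWeight {N : ℕ} (t : Fin N → ℝ) : ∑ X, cubeWeight t X = 1 := by
  have h := Fintype.prod_sum fun (i : Fin N) (b : Bool) => if b then t i else 1 - t i
  simp only [cubeWeight]
  rw [← h]
  simp

theorem sum_cubeWeight_mul_cubeMonomial {N : ℕ} (t : Fin N → ℝ) (S : Finset (Fin N)) :
    ∑ X, (cubeWeight t X : ℂ) * cubeMonomial S X = ∏ i ∈ S, (t i : ℂ) := by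
  have h := Fintype.prod_sum fun (i : Fin N) (b : Bool) =>
    ((if b then t i else 1 - t i : ℝ) : ℂ) * if i ∈ S then (if b then 1 else 0) else 1
  have h2 (X : Fin N → Bool) : (cubeWeight t X : ℂ) * cubeMonomial S X =
      ∏ i, ((if X i then t i else 1 - t i : ℝ) : ℂ) *
        if i ∈ S then (if X i then 1 else 0) else 1 := by
    rw [Finset.prod_mul_distrib, cubeWeight, cubeMonomial]
    push_cast
    congr 1
    simp [Finset.prod_ite_mem]
  simp_rw [h2]
  rw [← h, ← Finset.prod_subset (Finset.subset_univ S)]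
  · refine Finset.prod_congr rfl fun i hi => ?_
    simp [hi]
  · intro i _ hi
    simp [hi]

/-! ### The dual measure; blocks are residue classes mod `D` -/

theorem le_card_mod_fiber {N n D : ℕ} (hD : 0 < D) (h : D * n ≤ N) (b : Fin D) :
    n ≤ (Finset.univ.filter fun i : Fin N =>
      (⟨i.val % D, Nat.mod_lt _ hD⟩ : Fin D) = b).card := by
  have hlt (k : Fin n) : b.val + D * k.val < N := by
    have h1 : D * (k.val + 1) ≤ D * n := Nat.mul_le_mul_left D k.2
    have := b.2
    rw [mul_add] at h1
    omega
  conv_lhs => rw [← Fintype.card_fin n, ← Finset.card_univ]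
  refine Finset.card_le_card_of_injOn (fun k : Fin n => ⟨b.val + D * k.val, hlt k⟩) ?_ ?_
  · intro k _
    simp [Nat.mod_eq_of_lt b.2]
  · intro k _ l _ hkl
    have : D * k.val = D * l.val := by simpa using hkl
    exact Fin.ext (Nat.eq_of_mul_eq_mul_left hD this)

/-- A signed measure on the cube which annihilates all polynomials of degree less than
`D * (d + 1)`, has total variation at most `3 ^ D`, and gives weight at least `2 ^ (-D)` to `0`. -/
theorem exists_dual {N T D d n : ℕ} (hD : 0 < D) (hT : T < D * (d + 1)) (hN : D * n ≤ N)
    (h : 12 * d ^ 2 ≤ n) (hn : 1 ≤ n) :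
    ∃ W : (Fin N → Bool) → ℝ,
      (∀ f ∈ cubePolynomials N T, ∑ X, (W X : ℂ) * f X = 0) ∧
      ∑ X, |W X| ≤ 3 ^ D ∧ (1 / 2) ^ D ≤ W fun _ => false := by
  obtain ⟨β, τ, hτ, hβ, hβ2, hβn⟩ := exists_extrapolation h hn
  -- A signed measure on biases: unit mass at bias `0` (`none`) minus the extrapolation weights. Its
  -- moments up to order `d` vanish.
  let α : Option (Fin (d + 1)) → ℝ := fun o => o.elim 1 fun k => -β k
  let t : Option (Fin (d + 1)) → ℝ := fun o => o.elim 0 fun k => τ k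
  have ht (o) : t o ∈ Set.Icc (0 : ℝ) 1 := by
    cases o with
    | none => simp [t]
    | some k => exact hτ k
  have hα0 (s : ℕ) (hs : s ≤ d) : ∑ o, α o * t o ^ s = 0 := by
    have := hβ s hs
    rw [Finset.sum_range] at this
    simp [α, t, Fintype.sum_option, this]
  have hα1 : ∑ o, |α o| ≤ 3 := by
    rw [Finset.sum_range] at hβ2
    simp only [α, Fintype.sum_option, Option.elim, abs_neg, abs_one]
    linarith
  have hα2 (m : ℕ) (hm : n ≤ m) : 1 / 2 ≤ ∑ o, α o * (1 - t o) ^ m := by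
    rw [Finset.sum_range] at hβn
    simp only [α, t, Fintype.sum_option, Option.elim]
    have : ∑ k : Fin (d + 1), β k * (1 - τ k) ^ m ≤
        ∑ k : Fin (d + 1), |β k| * (1 - τ k) ^ n := by
      refine Finset.sum_le_sum fun k _ => ?_
      have h0 : 0 ≤ 1 - τ k := by linarith [(hτ k).2]
      exact mul_le_mul (le_abs_self _)
        (pow_le_pow_of_le_one h0 (by linarith [(hτ k).1]) hm) (pow_nonneg h0 _) (abs_nonneg _)
    simp only [neg_mul, Finset.sum_neg_distrib]
    simp
    linarith
  let b : Fin N → Fin D := fun i => ⟨i.val % D, Nat.mod_lt _ hD⟩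
  -- Each block `j` draws its own bias `t (θ j)`, so sums against `W` factor over the blocks.
  let W : (Fin N → Bool) → ℝ := fun X =>
    ∑ θ : Fin D → Option (Fin (d + 1)), (∏ j, α (θ j)) * cubeWeight (fun i => t (θ (b i))) X
  refine ⟨W, fun f hf => ?_, ?_, ?_⟩
  · have hmon (S : Finset (Fin N)) (hS : S.card ≤ T) :
        ∑ X, (W X : ℂ) * cubeMonomial S X = 0 := by
      have h1 : ∑ X, (W X : ℂ) * cubeMonomial S X =
          ((∑ θ : Fin D → Option (Fin (d + 1)), ∏ j, α (θ j) *
            t (θ j) ^ (S.filter fun i => b i = j).card : ℝ) : ℂ) := by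
        simp only [W]
        push_cast
        simp only [Finset.sum_mul]
        rw [Finset.sum_comm]
        refine Finset.sum_congr rfl fun θ _ => ?_
        simp only [mul_assoc]
        rw [← Finset.mul_sum, sum_cubeWeight_mul_cubeMonomial, Finset.prod_mul_distrib]
        congr 1
        rw [← Finset.prod_fiberwise' S b fun j => (t (θ j) : ℂ)]
        simp
      rw [h1]
      have h2 := Fintype.prod_sum fun (j : Fin D) (o : Option (Fin (d + 1))) =>
        α o * t o ^ (S.filter fun i => b i = j).card
      rw [← h2]
      -- Pigeonhole: more than `d` variables in every block would force `S.card ≥ D * (d + 1) > T`.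
      obtain ⟨j, hj⟩ : ∃ j, (S.filter fun i => b i = j).card ≤ d := by
        by_contra! hcon
        have h3 := Finset.card_eq_sum_card_fiberwise (f := b) (s := S) (t := Finset.univ)
          (by simp)
        have h4 : ∑ _j : Fin D, (d + 1) ≤ ∑ j, (S.filter fun i => b i = j).card :=
          Finset.sum_le_sum fun j _ => hcon j
        simp at h4
        omega
      rw [Finset.prod_eq_zero (Finset.mem_univ j) (hα0 _ hj)]
      simp
    induction hf using Submodule.span_induction with
    | mem f h =>
      obtain ⟨S, hS, rfl⟩ := h
      exact hmon S hS
    | zero => simp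
    | add f g _ _ hf hg => simp [mul_add, Finset.sum_add_distrib, hf, hg]
    | smul c f _ hf =>
      simp only [Pi.smul_apply, smul_eq_mul]
      simp only [mul_left_comm _ c]
      rw [← Finset.mul_sum, hf, mul_zero]
  · calc ∑ X, |W X| ≤ ∑ X, ∑ θ : Fin D → Option (Fin (d + 1)),
          (∏ j, |α (θ j)|) * cubeWeight (fun i => t (θ (b i))) X := by
          refine Finset.sum_le_sum fun X _ => (Finset.abs_sum_le_sum_abs _ _).trans_eq ?_
          refine Finset.sum_congr rfl fun θ _ => ?_
          rw [abs_mul, Finset.abs_prod, abs_of_nonneg (cubeWeight_nonneg (fun i => ht _) X)]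
      _ = ∑ θ : Fin D → Option (Fin (d + 1)), ∏ j, |α (θ j)| := by
          rw [Finset.sum_comm]
          refine Finset.sum_congr rfl fun θ _ => ?_
          rw [← Finset.mul_sum, sum_cubeWeight, mul_one]
      _ = ∏ _j : Fin D, ∑ o, |α o| :=
          (Fintype.prod_sum fun (_ : Fin D) (o : Option (Fin (d + 1))) => |α o|).symm
      _ ≤ 3 ^ D := by
          rw [Finset.prod_const, Finset.card_univ, Fintype.card_fin]
          exact pow_le_pow_left₀ (Finset.sum_nonneg fun _ _ => abs_nonneg _) hα1 D
  · have h1 : W (fun _ => false) = ∏ j : Fin D, ∑ o, α o *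
        (1 - t o) ^ (Finset.univ.filter fun i => b i = j).card := by
      rw [Fintype.prod_sum fun (j : Fin D) (o : Option (Fin (d + 1))) =>
        α o * (1 - t o) ^ (Finset.univ.filter fun i => b i = j).card]
      refine Finset.sum_congr rfl fun θ _ => ?_
      rw [Finset.prod_mul_distrib]
      congr 1
      simp only [cubeWeight, Bool.false_eq_true, if_false]
      rw [← Finset.prod_fiberwise' Finset.univ b fun j => 1 - t (θ j)]
      simp
    calc ((1 : ℝ) / 2) ^ D = ∏ _j : Fin D, (1 / 2 : ℝ) := by simp
      _ ≤ _ := by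
        rw [h1]
        exact Finset.prod_le_prod (fun _ _ => by norm_num) fun j _ =>
          hα2 _ (le_card_mod_fiber hD hN j)

/-! ### Amplitudes of a network as polynomials -/

namespace QuantumNetwork

theorem queryLabel_queryLabel {N k w : ℕ} (X : Fin N → Bool) (s : BasisState k w) :
    queryLabel X (queryLabel X s) = s := by
  obtain ⟨j, b, z⟩ := s
  simp only [queryLabel]
  split_ifs <;> simp

theorem queryGate_mulVec {N k w : ℕ} (X : Fin N → Bool) (v : BasisState k w → ℂ)
    (s : BasisState k w) : (queryGate k w X).mulVec v s = v (queryLabel X s) := by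
  have h (s' : BasisState k w) : s = queryLabel X s' ↔ s' = queryLabel X s := by
    constructor
    · rintro rfl
      rw [queryLabel_queryLabel]
    · rintro rfl
      rw [queryLabel_queryLabel]
  simp [Matrix.mulVec, dotProduct, queryGate, h]

theorem sum_norm_sq_mulVec {ι : Type*} [Fintype ι] [DecidableEq ι]
    (U : Matrix.unitaryGroup ι ℂ) (v : ι → ℂ) :
    ∑ s, ‖U.1.mulVec v s‖ ^ 2 = ∑ s, ‖v s‖ ^ 2 := by
  have h (u : ι → ℂ) : ((∑ s, ‖u s‖ ^ 2 : ℝ) : ℂ) = star u ⬝ᵥ u := by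
    simp [dotProduct, ← Complex.conj_mul']
  have hU : U.1.conjTranspose * U.1 = 1 := (Matrix.mem_unitaryGroup_iff' (A := U.1)).1 U.2
  have h2 : star (U.1.mulVec v) ⬝ᵥ U.1.mulVec v = star v ⬝ᵥ v := by
    rw [Matrix.star_mulVec, ← Matrix.dotProduct_mulVec, Matrix.mulVec_mulVec, hU,
      Matrix.one_mulVec]
  rw [← h, ← h] at h2
  exact_mod_cast h2

variable {N T : ℕ} {O : Type}

theorem sum_norm_sq_stateAfter (A : QuantumNetwork N T O) (X : Fin N → Bool) (t : ℕ)
    (h : t < T + 1) : ∑ s, ‖A.stateAfter X t h s‖ ^ 2 = 1 := by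
  induction t with
  | zero =>
    rw [stateAfter, sum_norm_sq_mulVec, Finset.sum_eq_single (zeroLabel A.k A.w)]
    · simp
    · intro s _ hs
      simp [hs]
    · simp
  | succ t ih =>
    rw [stateAfter, sum_norm_sq_mulVec, ← ih (Nat.lt_of_succ_lt h)]
    simp only [queryGate_mulVec]
    exact Equiv.sum_comp (Function.Involutive.toPerm _ (queryLabel_queryLabel X))
      fun s => ‖A.stateAfter X t (Nat.lt_of_succ_lt h) s‖ ^ 2

theorem mulVec_mem_cubePolynomials {ι : Type*} [Fintype ι] (U : Matrix ι ι ℂ)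
    {v : (Fin N → Bool) → ι → ℂ} (hv : ∀ s, (fun X => v X s) ∈ cubePolynomials N T) (s : ι) :
    (fun X => U.mulVec (v X) s) ∈ cubePolynomials N T := by
  have h : (fun X => U.mulVec (v X) s) = ∑ s', U s s' • fun X => v X s' := by
    ext X
    simp [Matrix.mulVec, dotProduct]
  rw [h]
  exact Submodule.sum_mem _ fun s' _ => Submodule.smul_mem _ _ (hv s')

/-- The amplitudes after `t` queries are polynomials of degree at most `t` in the black box. -/
theorem stateAfter_mem_cubePolynomials (A : QuantumNetwork N T O) (t : ℕ) (h : t < T + 1)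
    (s : BasisState A.k A.w) : (fun X => A.stateAfter X t h s) ∈ cubePolynomials N t := by
  induction t generalizing s with
  | zero => exact const_mem_cubePolynomials N 0 _
  | succ t ih =>
    simp only [stateAfter]
    refine mulVec_mem_cubePolynomials _ (fun s => ?_) s
    have ih' := ih (Nat.lt_of_succ_lt h)
    simp only [queryGate_mulVec]
    obtain ⟨j, b, z⟩ := s
    by_cases hj : j.val < N
    -- A query interpolates linearly in the bit: `a + x_j * (a' - a)`, which raises the degree by at
    -- most one.
    · have h1 : (fun X => A.stateAfter X t (Nat.lt_of_succ_lt h) (queryLabel X (j, b, z))) =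
          (fun X => A.stateAfter X t (Nat.lt_of_succ_lt h) (j, b, z)) +
          fun X => (if X ⟨j.val, hj⟩ then 1 else 0) *
            ((fun X => A.stateAfter X t (Nat.lt_of_succ_lt h) (j, !b, z)) -
              fun X => A.stateAfter X t (Nat.lt_of_succ_lt h) (j, b, z)) X := by
        ext X
        by_cases hX : X ⟨j.val, hj⟩ <;> simp [queryLabel, hj, hX]
      rw [h1]
      exact Submodule.add_mem _ (cubePolynomials_mono (Nat.le_succ t) (ih' _))
        (coord_mul_mem_cubePolynomials _ (Submodule.sub_mem _ (ih' _) (ih' _)))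
    · simp only [queryLabel, hj, dif_neg, not_false_eq_true]
      exact cubePolynomials_mono (Nat.le_succ t) (ih' _)

theorem outputProb_nonneg (A : QuantumNetwork N T O) (X : Fin N → Bool) (P : O → Prop) :
    0 ≤ A.outputProb X P := by
  classical
  exact Finset.sum_nonneg fun s _ => by split_ifs <;> positivity

theorem outputProb_mono (A : QuantumNetwork N T O) (X : Fin N → Bool) {P Q : O → Prop}
    (h : ∀ o, P o → Q o) : A.outputProb X P ≤ A.outputProb X Q := by
  classical
  refine Finset.sum_le_sum fun s _ => ?_
  by_cases hP : P (A.output s)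
  · simp [hP, h _ hP]
  · simp only [hP, if_false]
    split_ifs <;> positivity

theorem outputProb_add_not (A : QuantumNetwork N T O) (X : Fin N → Bool) (P : O → Prop) :
    A.outputProb X P + A.outputProb X (fun o => ¬ P o) = 1 := by
  classical
  rw [outputProb, outputProb, ← Finset.sum_add_distrib,
    ← A.sum_norm_sq_stateAfter X T (Nat.lt_succ_self T)]
  refine Finset.sum_congr rfl fun s _ => ?_
  by_cases hP : P (A.output s) <;> simp [hP, finalState]

/-! ### Error bound for OR and choice of parameters -/

theorem ComputesOR.nonneg {A : QuantumNetwork N T Bool} {ε : ℝ} (h : A.ComputesOR ε) : 0 ≤ ε :=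
  (A.outputProb_nonneg _ _).trans (h fun _ => false)

/-- A lower bound for the error of a network for OR, from a dual measure on the cube. -/
theorem ComputesOR.one_sub_le {A : QuantumNetwork N T Bool} {ε : ℝ} (hA : A.ComputesOR ε)
    {D d n : ℕ} (hD : 0 < D) (hT : T < D * (d + 1)) (hN : D * n ≤ N) (h : 12 * d ^ 2 ≤ n)
    (hn : 1 ≤ n) : 1 - ε ≤ 6 ^ D * Real.sqrt ε := by
  classical
  obtain ⟨W, hW, hW3, hW0⟩ := exists_dual hD hT hN h hn
  let z : Fin N → Bool := fun _ => false
  let S : Finset (BasisState A.k A.w) := Finset.univ.filter fun s => A.output s = false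
  have hprob (X : Fin N → Bool) :
      A.outputProb X (fun o => o = false) = ∑ s ∈ S, ‖A.finalState X s‖ ^ 2 := by
    simp only [outputProb, S, Finset.sum_filter]
    exact Finset.sum_congr rfl fun _ _ => by congr
  have hz : 1 - ε ≤ ∑ s ∈ S, ‖A.finalState z s‖ ^ 2 := by
    rw [← hprob]
    have h1 := A.outputProb_add_not z fun o => o = false
    have h2 := (A.outputProb_mono z (P := fun o => ¬ o = false)
      (Q := fun o => ¬ (o = true ↔ ∃ j, z j = true)) (by simp [z])).trans (hA z)
    linarith
  have hz1 : ∑ s ∈ S, ‖A.finalState z s‖ ^ 2 ≤ 1 := by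
    rw [← hprob]
    have h1 := A.outputProb_add_not z fun o => o = false
    have h2 := A.outputProb_nonneg z fun o => ¬ o = false
    linarith
  have hX (X : Fin N → Bool) (hne : X ≠ z) : ∑ s ∈ S, ‖A.finalState X s‖ ^ 2 ≤ ε := by
    rw [← hprob]
    refine (A.outputProb_mono X ?_).trans (hA X)
    obtain ⟨j, hj⟩ := Function.ne_iff.1 hne
    have hj' : ∃ j, X j = true := ⟨j, by simpa [z] using hj⟩
    rintro o rfl
    simp only [hj', iff_true]
    decide
  let g : (Fin N → Bool) → ℂ := fun X =>
    ∑ s ∈ S, (starRingEnd ℂ) (A.finalState z s) * A.finalState X s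
  have hg : g ∈ cubePolynomials N T := by
    have h1 : g = ∑ s ∈ S, (starRingEnd ℂ) (A.finalState z s) • fun X => A.finalState X s := by
      ext X
      simp [g]
    rw [h1]
    exact Submodule.sum_mem _ fun s _ => Submodule.smul_mem _ _
      (A.stateAfter_mem_cubePolynomials T (Nat.lt_succ_self T) s)
  have hgz : g z = ((∑ s ∈ S, ‖A.finalState z s‖ ^ 2 : ℝ) : ℂ) := by
    simp [g, Complex.conj_mul']
  have hgX (X : Fin N → Bool) (hne : X ≠ z) : ‖g X‖ ≤ Real.sqrt ε := by
    calc ‖g X‖ ≤ ∑ s ∈ S, ‖A.finalState z s‖ * ‖A.finalState X s‖ := by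
          refine (norm_sum_le _ _).trans_eq ?_
          simp
      _ ≤ Real.sqrt (∑ s ∈ S, ‖A.finalState z s‖ ^ 2) *
          Real.sqrt (∑ s ∈ S, ‖A.finalState X s‖ ^ 2) := Real.sum_mul_le_sqrt_mul_sqrt _ _ _
      _ ≤ 1 * Real.sqrt ε := by
          gcongr
          · exact Real.sqrt_le_one.2 hz1
          · exact hX X hne
      _ = Real.sqrt ε := one_mul _
  have hsum := hW g hg
  rw [← Finset.add_sum_erase _ _ (Finset.mem_univ z), add_eq_zero_iff_eq_neg] at hsum
  have hle : W z * (1 - ε) ≤ 3 ^ D * Real.sqrt ε := by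
    have hWz : 0 ≤ W z := le_trans (by positivity) hW0
    calc W z * (1 - ε) ≤ W z * ∑ s ∈ S, ‖A.finalState z s‖ ^ 2 := by gcongr
      _ ≤ ‖(W z : ℂ) * g z‖ := by
          rw [hgz, ← Complex.ofReal_mul, Complex.norm_real]
          exact le_abs_self _
      _ ≤ ∑ X ∈ Finset.univ.erase z, |W X| * Real.sqrt ε := by
          rw [hsum, norm_neg]
          refine (norm_sum_le _ _).trans (Finset.sum_le_sum fun X hX => ?_)
          rw [norm_mul, Complex.norm_real, Real.norm_eq_abs]
          gcongr
          exact hgX X (Finset.ne_of_mem_erase hX)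
      _ ≤ ∑ X, |W X| * Real.sqrt ε :=
          Finset.sum_le_sum_of_subset_of_nonneg (Finset.erase_subset _ _)
            fun _ _ _ => by positivity
      _ ≤ 3 ^ D * Real.sqrt ε := by
          rw [← Finset.sum_mul]
          gcongr
  rcases le_total ε 1 with hε | hε
  · have h1 : (1 / 2 : ℝ) ^ D * (1 - ε) ≤ 3 ^ D * Real.sqrt ε :=
      (mul_le_mul_of_nonneg_right hW0 (by linarith)).trans hle
    have h2 : (1 - ε) = 2 ^ D * ((1 / 2 : ℝ) ^ D * (1 - ε)) := by
      rw [← mul_assoc, ← mul_pow]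
      norm_num
    calc 1 - ε = 2 ^ D * ((1 / 2 : ℝ) ^ D * (1 - ε)) := h2
      _ ≤ 2 ^ D * (3 ^ D * Real.sqrt ε) := by gcongr
      _ = 6 ^ D * Real.sqrt ε := by rw [← mul_assoc, ← mul_pow]; norm_num
  · exact (sub_nonpos.2 hε).trans (by positivity)

/-- Take `d ≈ N / (24 * T)`, `D ≈ T / d` and blocks of size `12 * d ^ 2`. The hypothesis `N ≤ T ^ 2`
gives `d ≤ T`, so rounding at most doubles `D * d`. -/
theorem exists_blocks {N T : ℕ} (hTN : T < N) (hT : N ≤ T ^ 2) :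
    ∃ D d n : ℕ, 0 < D ∧ T < D * (d + 1) ∧ D * n ≤ N ∧ 12 * d ^ 2 ≤ n ∧ 1 ≤ n ∧
      D * N ≤ 576 * T ^ 2 := by
  have hT0 : 0 < T := by
    rcases Nat.eq_zero_or_pos T with rfl | h
    · simp at hT; omega
    · exact h
  rcases le_or_gt (24 * T) N with h | h
  · have hd : 1 ≤ N / (24 * T) := (Nat.one_le_div_iff (by omega)).2 h
    have hdN : N / (24 * T) * (24 * T) ≤ N := Nat.div_mul_le_self _ _
    have hdN' : N < (N / (24 * T) + 1) * (24 * T) := Nat.lt_mul_of_div_lt (Nat.lt_succ_self _) (by omega)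
    generalize N / (24 * T) = d at *
    have hdT : d ≤ T := by nlinarith
    have hD : T / d * d ≤ T := Nat.div_mul_le_self _ _
    have hD' : T < (T / d + 1) * d := Nat.lt_mul_of_div_lt (Nat.lt_succ_self _) (by omega)
    generalize T / d = e at *
    refine ⟨e + 1, d, 12 * d ^ 2, by omega, by nlinarith, ?_, le_rfl, by nlinarith, ?_⟩
    · have : (e + 1) * d ≤ 2 * T := by nlinarith
      nlinarith
    · have h1 : (e + 1) * d ≤ 2 * T := by nlinarith
      have h2 : N ≤ 48 * T * d := by nlinarith
      calc (e + 1) * N ≤ (e + 1) * (48 * T * d) := Nat.mul_le_mul_left _ h2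
        _ = 48 * T * ((e + 1) * d) := by ring
        _ ≤ 48 * T * (2 * T) := Nat.mul_le_mul_left _ h1
        _ ≤ 576 * T ^ 2 := by nlinarith
  -- Here `T` is of order `N`: single-coordinate blocks suffice because `T < N`, and `N < 24 * T`
  -- yields `576 = 24 ^ 2`.
  · exact ⟨N, 0, 1, by omega, by omega, by omega, by omega, le_rfl, by nlinarith⟩

/-- The trade-off between the number of queries and the error probability for OR. -/
theorem ComputesOR.lower_bound {A : QuantumNetwork N T Bool} {ε : ℝ} (hA : A.ComputesOR ε)
    (hTN : T < N) (hT : N ≤ T ^ 2) :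
    0 < ε ∧ 1 / 60 * Real.sqrt (N * Real.log (1 / ε)) ≤ T := by
  obtain ⟨D, d, n, hD, hTD, hDN, hdn, hn, hDT⟩ := exists_blocks hTN hT
  have hmain := hA.one_sub_le hD hTD hDN hdn hn
  have hε : 0 < ε := by
    refine hA.nonneg.lt_of_ne ?_
    rintro rfl
    norm_num at hmain
  have hlog : Real.log (1 / ε) ≤ 5 * D := by
    rw [one_div, Real.log_inv]
    have hD1 : (1 : ℝ) ≤ D := by exact_mod_cast hD
    have hs := Real.sqrt_pos.2 hε
    -- For `ε ≤ 1 / 2` the factor `1 - ε ≥ 1 / 2` is absorbed into `2 ^ D`; larger `ε` needs no dual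
    -- measure.
    have hle : 1 ≤ 12 ^ D * Real.sqrt ε := by
      rcases le_total ε (1 / 2) with h | h
      · have h2 : (2 : ℝ) ≤ 2 ^ D := le_self_pow₀ (by norm_num) hD.ne'
        calc (1 : ℝ) ≤ 2 * (6 ^ D * Real.sqrt ε) := by linarith
          _ ≤ 2 ^ D * (6 ^ D * Real.sqrt ε) := by gcongr
          _ = 12 ^ D * Real.sqrt ε := by rw [← mul_assoc, ← mul_pow]; norm_num
      · have h2 : (12 : ℝ) ≤ 12 ^ D := le_self_pow₀ (by norm_num) hD.ne'
        have h3 : 1 / 2 ≤ Real.sqrt ε := Real.le_sqrt_of_sq_le (by linarith)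
        nlinarith
    have h4 := Real.log_nonneg hle
    rw [Real.log_mul (by positivity) hs.ne', Real.log_pow, Real.log_sqrt hε.le] at h4
    have h5 : Real.log 12 ≤ 5 / 2 := by
      rw [Real.log_le_iff_le_exp (by norm_num), show (5 / 2 : ℝ) = 1 + 1 + 1 / 2 by norm_num,
        Real.exp_add, Real.exp_add]
      have h6 := Real.exp_one_gt_d9
      have h7 : (1.64 : ℝ) ≤ Real.exp (1 / 2) := by
        by_contra! hcon
        have h8 : Real.exp (1 / 2) * Real.exp (1 / 2) = Real.exp 1 := by
          rw [← Real.exp_add]; norm_num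
        have := Real.exp_pos (1 / 2)
        nlinarith
      nlinarith [Real.exp_pos (1 / 2)]
    nlinarith
  refine ⟨hε, ?_⟩
  have hN : (N : ℝ) * Real.log (1 / ε) ≤ (60 * T) ^ 2 := by
    have h1 : (D * N : ℝ) ≤ 576 * T ^ 2 := by exact_mod_cast hDT
    calc (N : ℝ) * Real.log (1 / ε) ≤ N * (5 * D) := by gcongr
      _ ≤ (60 * T) ^ 2 := by nlinarith [sq_nonneg (T : ℝ)]
  have := Real.sqrt_le_sqrt hN
  rw [Real.sqrt_sq (by positivity)] at this
  linarith

/-! ### Reduction of search to OR, and the asymptotic statement -/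

/-- The network for OR which reports whether a search has been successful. -/
def found (A : QuantumNetwork N T (Option (Fin N))) : QuantumNetwork N T Bool where
  k := A.k
  hk := A.hk
  w := A.w
  U := A.U
  output s := (A.output s).isSome

theorem stateAfter_found (A : QuantumNetwork N T (Option (Fin N))) (X : Fin N → Bool) (t : ℕ)
    (h : t < T + 1) : A.found.stateAfter X t h = A.stateAfter X t h := by
  induction t with
  | zero => rfl
  | succ t ih =>
    rw [stateAfter, stateAfter, ih]
    rfl

theorem Searches.computesOR {A : QuantumNetwork N T (Option (Fin N))} {ε : ℝ}
    (hA : A.Searches ε) : A.found.ComputesOR ε := by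
  intro X
  have h : A.found.outputProb X (fun o => ¬ (o = true ↔ ∃ j, X j = true)) =
      A.outputProb X fun o => ¬ (o.isSome = true ↔ ∃ j, X j = true) := by
    rw [outputProb, outputProb]
    unfold finalState
    rw [stateAfter_found]
    rfl
  rw [h]
  refine (A.outputProb_mono X fun o ho hans => ho ?_).trans (hA X)
  cases o with
  | none => simpa [IsSearchAnswer] using hans
  | some j => simpa using ⟨j, hans⟩

end QuantumNetwork

theorem eventually_le_sq_of_tendsto {T : ℕ → ℕ}
    (h : Tendsto (fun N : ℕ => (T N : ℝ) / Real.sqrt (N : ℝ)) atTop atTop) :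
    ∀ᶠ N : ℕ in atTop, N ≤ T N ^ 2 := by
  filter_upwards [h.eventually_ge_atTop 1, eventually_gt_atTop 0] with N h1 h0
  have hN : 0 < Real.sqrt N := Real.sqrt_pos.2 (by exact_mod_cast h0)
  rw [one_le_div hN, Real.sqrt_le_left (by positivity)] at h1
  exact_mod_cast h1

theorem mainTheorem4 :
    ∃ c : ℝ, 0 < c ∧
      (∀ (T : ℕ → ℕ) (ε : ℕ → ℝ) (A : ∀ N : ℕ, QuantumNetwork N (T N) Bool),
        Tendsto (fun N : ℕ => (T N : ℝ) / Real.sqrt (N : ℝ)) atTop atTop →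
        (∀ᶠ N : ℕ in atTop, T N < N) →
        (∀ᶠ N : ℕ in atTop, (A N).ComputesOR (ε N)) →
        ∀ᶠ N : ℕ in atTop,
          0 < ε N ∧ c * Real.sqrt ((N : ℝ) * Real.log (1 / ε N)) ≤ (T N : ℝ)) ∧
      (∀ (T : ℕ → ℕ) (ε : ℕ → ℝ) (A : ∀ N : ℕ, QuantumNetwork N (T N) (Option (Fin N))),
        Tendsto (fun N : ℕ => (T N : ℝ) / Real.sqrt (N : ℝ)) atTop atTop →
        (∀ᶠ N : ℕ in atTop, T N < N) →
        (∀ᶠ N : ℕ in atTop, (A N).Searches (ε N)) →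
        ∀ᶠ N : ℕ in atTop,
          0 < ε N ∧ c * Real.sqrt ((N : ℝ) * Real.log (1 / ε N)) ≤ (T N : ℝ)) := by
  refine ⟨1 / 60, by norm_num, fun T ε A hT hTN hA => ?_, fun T ε A hT hTN hA => ?_⟩
  · filter_upwards [eventually_le_sq_of_tendsto hT, hTN, hA] with N h1 h2 h3
    exact h3.lower_bound h2 h1
  · filter_upwards [eventually_le_sq_of_tendsto hT, hTN, hA] with N h1 h2 h3
    exact h3.computesOR.lower_bound h2 h1
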